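/- For every total sample size $T\in\mathbb N$ let $R=R_T$ and $P=P_T=T-R_T$ be the in-sample and out-of-sample sizes, let $p=p_T$, and let $\{Z_t\}_{t\in\mathbb Z}$, $Z_t=(Y_t,X_t)$, be a strictly stationary process with values in $\mathbb R\times\mathbb R^{p}$ on a probability space (the process, the space and $p$ may depend on $T$). Put $\mathcal F_t=\sigma(Z_s,\,s\le t)$ and assume that $X_t$ is $\mathcal F_{t-1}$-measurable and includes an intercept (one of its coordinates, the same for all $t$, equals $1$ a.s.). Write $\hat E_P[g_t]=P^{-1}\sum_{t=R+1}^{T}g_t$, $\|M\|=\sqrt{\operatorname{tr}(M'M)}$ for matrices and vectors, $\lambda_{\min},\lambda_{\max}$ for the smallest and largest eigenvalue of a symmetric matrix, and $$\Sigma=E[X_tX_t'],\quad \sigma_t^2=E[Y_t^2\mid\mathcal F_{t-1}],\quad \hat A=\hat E_P[Y_t^2X_tX_t'],\quad \hat B=\hat E_P[\sigma_t^2X_tX_t'],\quad A=B=E[Y_t^2X_tX_t'].$$ Let $\widehat\theta$ be an estimator based on the in-sample observations, i.e. a $\sigma(Z_1,\dots,Z_R)$-measurable random vector with values in a parameter space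 $\Theta\subset\mathbb R^{p}$. Assume: (A1) $R,P\to\infty$ as $T\to\infty$, and $\lim_{T\to\infty}P/R=\pi$ with $0\le\pi<\infty$. ($\Sigma$) $E\|X_t\|^2<\infty$ and $\lambda_{\max}(\Sigma)\le C<\infty$, with $C$ independent of $T$ and $p$. (A9) (i) For every $T$, $\Theta$ is bounded and $\Pr(\widehat\theta=0)=0$. There is a $\delta>0$ such that (ii) $E\big[\|Y_tX_t\|^{2+\delta}\big]\le C<\infty$, with $C$ independent of $T$ and $p$; and (iii) $$\max\{\|\hat A-A\|,\|\hat B-B\|\}=o_{\mathbb P}(\lambda_{\min}(A))\quad\text{and}\quad(\lambda_{\min}(A))^{1+\delta/2}P^{\delta/2}\to\infty .$$ Then, under the martingale difference hypothesis $E[Y_t\mid\mathcal F_{t-1}]=0$ a.s. for all $t$, $$\hat t=\frac{\sqrt P\,\hat E_P[Y_tX_t'\widehat\theta]}{\sqrt{\hat E_P[(Y_tX_t'\widehat\theta)^2]}}\ \overset{d}{\longrightarrow}\ N(0,1)\qquad(T\to\infty).$$ -/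

import Mathlib

open MeasureTheory ProbabilityTheory Filter Topology
open scoped ENNReal NNReal

/-- The `σ`-field `σ(Z_s, s ∈ S)` generated by `Z_s = (Y_s, X_s)`, `s ∈ S`. -/
@[reducible] def sigmaZ {Ω : Type*} {p : ℕ} (Y : ℤ → Ω → ℝ) (X : ℤ → Ω → EuclideanSpace ℝ (Fin p))
    (S : Set ℤ) : MeasurableSpace Ω :=
  ⨆ s ∈ S, MeasurableSpace.comap (fun ω => (Y s ω, X s ω)) inferInstance

/-- `F_t = σ(Z_s, s ≤ t)`. -/
@[reducible] def sigmaPast {Ω : Type*} {p : ℕ} (Y : ℤ → Ω → ℝ) (X : ℤ → Ω → EuclideanSpace ℝ (Fin p))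
    (t : ℤ) : MeasurableSpace Ω :=
  sigmaZ Y X (Set.Iic t)

/-- Strict stationarity: the law of the whole process is invariant under time shifts. -/
def StrictlyStationary {Ω E : Type*} [MeasurableSpace Ω] [MeasurableSpace E]
    (μ : Measure Ω) (Z : ℤ → Ω → E) : Prop :=
  ∀ h : ℤ, IdentDistrib (fun ω (t : ℤ) => Z (t + h) ω) (fun ω (t : ℤ) => Z t ω) μ μ

/-- The out-of-sample mean `P⁻¹ ∑_{t = R+1}^{T} g_t`, `P = T - R`. -/
noncomputable def outMean {E : Type*} [AddCommGroup E] [Module ℝ E] (R T : ℕ) (g : ℤ → E) : E :=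
  ((T - R : ℕ) : ℝ)⁻¹ • ∑ t ∈ Finset.Ioc (R : ℤ) (T : ℤ), g t

/-- The matrix `x x'`. -/
def outer {p : ℕ} (x : EuclideanSpace ℝ (Fin p)) : Matrix (Fin p) (Fin p) ℝ :=
  Matrix.of fun i j => x i * x j

/-- The entrywise expectation of a random matrix. -/
noncomputable def matrixMean {Ω : Type*} [MeasurableSpace Ω] {p : ℕ} (μ : Measure Ω)
    (M : Ω → Matrix (Fin p) (Fin p) ℝ) : Matrix (Fin p) (Fin p) ℝ :=
  Matrix.of fun i j => ∫ ω, M ω i j ∂μ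

/-- The Euclidean norm `√(tr (M' M))` of a matrix. -/
noncomputable def euclNorm {p : ℕ} (M : Matrix (Fin p) (Fin p) ℝ) : ℝ :=
  √((M.transpose * M).trace)

/-- Smallest eigenvalue (used for symmetric matrices of positive size). -/
noncomputable def lambdaMin {p : ℕ} (M : Matrix (Fin p) (Fin p) ℝ) : ℝ := sInf (spectrum ℝ M)

/-- Largest eigenvalue (used for symmetric matrices of positive size). -/
noncomputable def lambdaMax {p : ℕ} (M : Matrix (Fin p) (Fin p) ℝ) : ℝ := sSup (spectrum ℝ M)

/-- `Σ = E[X_t X_t']`; under stationarity it does not depend on `t`, and `t = 1` is used. -/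
noncomputable def sigmaMat {Ω : Type*} [MeasurableSpace Ω] {p : ℕ} (μ : Measure Ω)
    (X : ℤ → Ω → EuclideanSpace ℝ (Fin p)) : Matrix (Fin p) (Fin p) ℝ :=
  matrixMean μ fun ω => outer (X 1 ω)

/-- `A = B = E[Y_t² X_t X_t']`; under stationarity it does not depend on `t`, and `t = 1`
is used. -/
noncomputable def matA {Ω : Type*} [MeasurableSpace Ω] {p : ℕ} (μ : Measure Ω)
    (Y : ℤ → Ω → ℝ) (X : ℤ → Ω → EuclideanSpace ℝ (Fin p)) : Matrix (Fin p) (Fin p) ℝ :=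
  matrixMean μ fun ω => (Y 1 ω) ^ 2 • outer (X 1 ω)

/-- `σ_t² = E[Y_t² | F_{t-1}]`. -/
noncomputable def condSq {Ω : Type*} [MeasurableSpace Ω] {p : ℕ} (μ : Measure Ω)
    (Y : ℤ → Ω → ℝ) (X : ℤ → Ω → EuclideanSpace ℝ (Fin p)) (t : ℤ) : Ω → ℝ :=
  μ[fun ω => (Y t ω) ^ 2 | sigmaPast Y X (t - 1)]

/-- `Â = Ê_P[Y_t² X_t X_t']`. -/
noncomputable def matAhat {Ω : Type*} {p : ℕ} (Y : ℤ → Ω → ℝ)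
    (X : ℤ → Ω → EuclideanSpace ℝ (Fin p)) (R T : ℕ) (ω : Ω) : Matrix (Fin p) (Fin p) ℝ :=
  outMean R T fun t => (Y t ω) ^ 2 • outer (X t ω)

/-- `B̂ = Ê_P[σ_t² X_t X_t']`. -/
noncomputable def matBhat {Ω : Type*} [MeasurableSpace Ω] {p : ℕ} (μ : Measure Ω)
    (Y : ℤ → Ω → ℝ) (X : ℤ → Ω → EuclideanSpace ℝ (Fin p)) (R T : ℕ) (ω : Ω) :
    Matrix (Fin p) (Fin p) ℝ :=
  outMean R T fun t => condSq μ Y X t ω • outer (X t ω)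

/-- `ξ_T = o_ℙ(a_T)`, where `ξ_T` lives on the probability space `(Ω_T, μ_T)`. -/
def IsLittleOP {Ω : ℕ → Type*} [∀ T, MeasurableSpace (Ω T)] (μ : ∀ T, Measure (Ω T))
    (ξ : ∀ T, Ω T → ℝ) (a : ℕ → ℝ) : Prop :=
  ∀ ε : ℝ, 0 < ε → Tendsto (fun T => μ T {ω | ε * a T < |ξ T ω|}) atTop (𝓝 0)

/-- The self-normalized statistic
`t̂ = √P Ê_P[Y_t X_t'θ̂] / √(Ê_P[(Y_t X_t'θ̂)²])`. -/
noncomputable def tStat {Ω : Type*} {p : ℕ} (Y : ℤ → Ω → ℝ)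
    (X : ℤ → Ω → EuclideanSpace ℝ (Fin p)) (θhat : Ω → EuclideanSpace ℝ (Fin p))
    (R T : ℕ) (ω : Ω) : ℝ :=
  √((T - R : ℕ) : ℝ) * outMean R T (fun t => Y t ω * inner ℝ (X t ω) (θhat ω)) /
    √(outMean R T fun t => (Y t ω * inner ℝ (X t ω) (θhat ω)) ^ 2)

/-! The in-sample estimator is known at time `R`, so conditionally on the past it acts as a fixed
direction, and `Y_t X_t'θ̂`, `t > R`, are martingale differences. Dividing by the random but
`F_R`-measurable scale `√(P θ̂'Aθ̂)` preserves this and leaves the statistic unchanged: `t̂ = ∑ D_k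
/ √(∑ D_k²)`.

Two estimates, both free of the length of `θ̂`, put the array `D_k` within reach of a martingale
CLT. Since `θ'Aθ ≥ λ_min(A) ‖θ‖²`, first, `|∑ D_k² - 1| = |θ̂'(Â - A)θ̂| / θ̂'Aθ̂ ≤ ‖Â - A‖ /
λ_min(A)`, which tends to `0` in probability (`abs_sum_normDiff_sq_sub_one_le`); second, `|D_k| ≤
‖Y_t X_t‖ / √(P λ_min(A))`, so the Lyapunov sum is at most `C / (λ_min(A)^(1+δ/2) P^(δ/2)) → 0`
(`sum_integral_abs_normDiff_rpow_le`).

The CLT follows McLeish. The stopped product `∏ (1 + i t D_k)` has expectation exactly `1`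
(`integral_mcLeishProd`). When `∑ D_k²` is near `1` and every `D_k` is small, `exp(i t ∑ D_k)` is
close to `e^{-t²/2}` times that product; elsewhere the difference is controlled by a probability and
the Lyapunov sum (`norm_exp_sub_mcLeishProd_le`). Integration gives convergence of characteristic
functions. Slutsky's theorem then replaces the scale by `√(∑ D_k²)`. -/

/-- McLeish's product `∏ (1 + i t x_k)`, in which the factors are switched off as soon as
the sum of the squares has passed `2`. -/
noncomputable def mcLeishProd (t : ℝ) (x : ℕ → ℝ) (n : ℕ) : ℂ :=
  ∏ k ∈ Finset.range n,
    (1 + Complex.I * ((t * if ∑ j ∈ Finset.range k, x j ^ 2 ≤ 2 then x k else 0 : ℝ) : ℂ))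

/-! ### Pointwise estimates for McLeish's product -/

lemma norm_one_add_I_mul_sq (y : ℝ) : ‖1 + Complex.I * (y : ℂ)‖ ^ 2 = 1 + y ^ 2 := by
  rw [Complex.sq_norm, Complex.normSq_apply]
  simp
  ring

lemma norm_one_add_I_mul_le_exp (y : ℝ) :
    ‖1 + Complex.I * (y : ℂ)‖ ≤ Real.exp (y ^ 2 / 2) := by
  refine le_of_sq_le_sq ?_ (Real.exp_nonneg _)
  rw [norm_one_add_I_mul_sq, ← Real.exp_nat_mul]
  have := Real.add_one_le_exp (y ^ 2)
  calc 1 + y ^ 2 ≤ Real.exp (y ^ 2) := by linarith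
    _ = _ := by congr 1; push_cast; ring

lemma norm_mcLeishProd_le_exp (t : ℝ) (x : ℕ → ℝ) (n : ℕ) :
    ‖mcLeishProd t x n‖ ≤ Real.exp (t ^ 2 * (∑ j ∈ Finset.range n, x j ^ 2) / 2) := by
  induction n with
  | zero => simp [mcLeishProd]
  | succ n ih =>
    rw [mcLeishProd, Finset.prod_range_succ, norm_mul, Finset.sum_range_succ, mul_add, add_div,
      Real.exp_add]
    gcongr
    · exact ih
    · refine (norm_one_add_I_mul_le_exp _).trans ?_
      gcongr
      split_ifs
      · rw [mul_pow]
      · simp; positivity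

/-- At the last active factor the earlier squares still sum to at most `2`, so the preceding product
is at most `e^{t²}`; that one factor costs `1 + |t| m`. The bound is therefore linear in the largest
term, which makes the product integrable without higher moments. -/
lemma norm_mcLeishProd_le (t : ℝ) (x : ℕ → ℝ) (n : ℕ) (m : ℝ) (hm0 : 0 ≤ m)
    (hm : ∀ k < n, |x k| ≤ m) :
    ‖mcLeishProd t x n‖ ≤ Real.exp (t ^ 2) * (1 + |t| * m) := by
  induction n with
  | zero =>
    have : (1 : ℝ) ≤ Real.exp (t ^ 2) := Real.one_le_exp (sq_nonneg t)
    have h2 : 0 ≤ |t| * m := by positivity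
    simp only [mcLeishProd, Finset.range_zero, Finset.prod_empty, norm_one]
    nlinarith
  | succ n ih =>
    by_cases hQ : ∑ j ∈ Finset.range n, x j ^ 2 ≤ 2
    · have h1 := norm_mcLeishProd_le_exp t x n
      rw [mcLeishProd, Finset.prod_range_succ, norm_mul, if_pos hQ]
      gcongr
      · refine h1.trans (Real.exp_le_exp.2 ?_)
        nlinarith [sq_nonneg t]
      · refine (norm_add_le _ _).trans ?_
        simp only [norm_one, norm_mul, Complex.norm_I, one_mul, Complex.norm_real,
          Real.norm_eq_abs]
        gcongr
        exact hm n (by simp)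
    · rw [mcLeishProd, Finset.prod_range_succ, if_neg hQ]
      simpa [mcLeishProd] using ih fun k hk => hm k (by omega)

/-- Partial sums of squares increase, so no factor has been switched off. -/
lemma mcLeishProd_eq_of_sum_le {t : ℝ} {x : ℕ → ℝ} {n : ℕ}
    (h : ∑ j ∈ Finset.range n, x j ^ 2 ≤ 2) :
    mcLeishProd t x n = ∏ k ∈ Finset.range n, (1 + Complex.I * ((t * x k : ℝ) : ℂ)) := by
  refine Finset.prod_congr rfl fun k hk => ?_
  rw [if_pos]
  refine le_trans (Finset.sum_le_sum_of_subset_of_nonneg ?_ fun _ _ _ => sq_nonneg _) h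
  exact Finset.range_subset_range.2 (Finset.mem_range.1 hk).le

lemma norm_exp_I_mul_sub_le {y : ℝ} (hy : |y| ≤ 1) :
    ‖Complex.exp (Complex.I * y) - (1 + Complex.I * y) * Complex.exp (-(y : ℂ) ^ 2 / 2)‖
      ≤ 2 * |y| ^ 3 := by
  have hI : ‖Complex.I * (y : ℂ)‖ = |y| := by simp
  have hn : ‖-(y : ℂ) ^ 2 / 2‖ = |y| ^ 2 / 2 := by simp
  have h0 := abs_nonneg y
  have h1 := Complex.exp_bound (x := Complex.I * y) (by rwa [hI]) (n := 3) (by norm_num)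
  have h2 := Complex.exp_bound (x := -(y : ℂ) ^ 2 / 2) (by rw [hn]; nlinarith) (n := 2)
    (by norm_num)
  rw [hI] at h1
  rw [hn] at h2
  simp only [Finset.sum_range_succ, Finset.range_zero, Finset.sum_empty] at h1 h2
  norm_num [Nat.factorial] at h1 h2
  have hlin : ‖1 + Complex.I * (y : ℂ)‖ ≤ 2 := by
    refine (norm_add_le _ _).trans ?_
    rw [hI]; norm_num; linarith
  -- The quadratic Taylor polynomials match: `(1 + iy)(1 - y²/2)` differs from `1 + iy + (iy)²/2`
  -- only by `-iy³/2`.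
  have e : Complex.exp (Complex.I * y) - (1 + Complex.I * y) * Complex.exp (-(y : ℂ) ^ 2 / 2)
      = (Complex.exp (Complex.I * y) - (1 + Complex.I * y + (Complex.I * y) ^ 2 / 2))
        - (1 + Complex.I * y) * (Complex.exp (-(y : ℂ) ^ 2 / 2) - (1 + -(y : ℂ) ^ 2 / 2))
        + Complex.I * (y : ℂ) ^ 3 / 2 := by
    have := Complex.I_sq
    linear_combination ((y : ℂ) ^ 2 / 2) * this
  have h3 : ‖Complex.I * (y : ℂ) ^ 3 / 2‖ = |y| ^ 3 / 2 := by simp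
  rw [e]
  refine (norm_add_le _ _).trans ?_
  rw [h3]
  refine (add_le_add_left (norm_sub_le _ _) _).trans ?_
  rw [norm_mul]
  have h4 : |y| ^ 4 ≤ |y| ^ 3 := pow_le_pow_of_le_one h0 hy (by norm_num)
  have h5 := mul_le_mul hlin h2 (norm_nonneg _) (by norm_num)
  have h6 : |y| ^ 4 = y ^ 4 := Even.pow_abs (by decide) y
  have h7 : 0 ≤ |y| ^ 3 := by positivity
  nlinarith

/-- Telescoping: one factor is exchanged at a time. The exchanged factor costs `2|y|³`, and the
remaining ones are bounded by `1` or by `exp(y²/2)`. -/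
lemma norm_prod_exp_sub_le (s : Finset ℕ) (y : ℕ → ℝ) (hy : ∀ k ∈ s, |y k| ≤ 1) :
    ‖Complex.exp (Complex.I * ((∑ k ∈ s, y k : ℝ) : ℂ))
        - (∏ k ∈ s, (1 + Complex.I * (y k : ℂ))) *
          Complex.exp (-((∑ k ∈ s, y k ^ 2 : ℝ) : ℂ) / 2)‖
      ≤ 2 * Real.exp ((∑ k ∈ s, y k ^ 2) / 2) * ∑ k ∈ s, |y k| ^ 3 := by
  induction s using Finset.induction_on with
  | empty => simp
  | insert a s ha ih =>
    have ih := ih fun k hk => hy k (Finset.mem_insert_of_mem hk)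
    have ha1 := norm_exp_I_mul_sub_le (hy a (Finset.mem_insert_self _ _))
    rw [Finset.sum_insert ha, Finset.prod_insert ha, Finset.sum_insert ha, Finset.sum_insert ha]
    set S := ∑ k ∈ s, y k
    set Q := ∑ k ∈ s, y k ^ 2
    set C := ∑ k ∈ s, |y k| ^ 3
    set Z := ∏ k ∈ s, (1 + Complex.I * (y k : ℂ))
    have hC : 0 ≤ C := by positivity
    have e1 : Complex.exp (Complex.I * ((y a + S : ℝ) : ℂ))
        = Complex.exp (Complex.I * y a) * Complex.exp (Complex.I * S) := by
      rw [← Complex.exp_add]; push_cast; ring_nf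
    have e2 : Complex.exp (-((y a ^ 2 + Q : ℝ) : ℂ) / 2)
        = Complex.exp (-(y a : ℂ) ^ 2 / 2) * Complex.exp (-(Q : ℂ) / 2) := by
      rw [← Complex.exp_add]; push_cast; ring_nf
    have e3 : Complex.exp (Complex.I * ((y a + S : ℝ) : ℂ))
        - ((1 + Complex.I * (y a : ℂ)) * Z) * Complex.exp (-((y a ^ 2 + Q : ℝ) : ℂ) / 2)
        = (Complex.exp (Complex.I * y a)
            - (1 + Complex.I * y a) * Complex.exp (-(y a : ℂ) ^ 2 / 2))
              * Complex.exp (Complex.I * S)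
          + (1 + Complex.I * y a) * Complex.exp (-(y a : ℂ) ^ 2 / 2)
            * (Complex.exp (Complex.I * S) - Z * Complex.exp (-(Q : ℂ) / 2)) := by
      rw [e1, e2]; ring
    rw [e3]
    have n1 : ‖Complex.exp (Complex.I * (S : ℂ))‖ = 1 := by
      rw [Complex.norm_exp]; simp
    have n2 : ‖Complex.exp (-(y a : ℂ) ^ 2 / 2)‖ ≤ 1 := by
      rw [Complex.norm_exp]
      rw [Real.exp_le_one_iff]
      have : (-(y a : ℂ) ^ 2 / 2) = ((-(y a) ^ 2 / 2 : ℝ) : ℂ) := by push_cast; ring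
      rw [this, Complex.ofReal_re]
      nlinarith [sq_nonneg (y a)]
    have n3 := norm_one_add_I_mul_le_exp (y a)
    have n4 : 1 ≤ Real.exp (y a ^ 2 / 2) := Real.one_le_exp (by positivity)
    have n5 : 1 ≤ Real.exp (Q / 2) := Real.one_le_exp (by positivity)
    refine (norm_add_le _ _).trans ?_
    rw [norm_mul, n1, norm_mul, norm_mul, mul_one, add_div, Real.exp_add]
    calc _ ≤ 2 * |y a| ^ 3 + Real.exp (y a ^ 2 / 2) * 1 * (2 * Real.exp (Q / 2) * C) := by
          gcongr
      _ ≤ 2 * (Real.exp (y a ^ 2 / 2) * Real.exp (Q / 2)) * |y a| ^ 3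
          + Real.exp (y a ^ 2 / 2) * 1 * (2 * Real.exp (Q / 2) * C) := by
          gcongr
          have := one_le_mul_of_one_le_of_one_le n4 n5
          linarith
      _ = _ := by ring

lemma abs_exp_neg_sub_exp_neg_le {a b : ℝ} (ha : 0 ≤ a) (hb : 0 ≤ b) :
    |Real.exp (-a) - Real.exp (-b)| ≤ |a - b| := by
  wlog h : a ≤ b generalizing a b
  · rw [abs_sub_comm, abs_sub_comm a]
    exact this hb ha (le_of_not_ge h)
  have h1 : Real.exp (-b) ≤ Real.exp (-a) := Real.exp_le_exp.2 (by linarith)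
  have h2 : Real.exp (-b) = Real.exp (-a) * Real.exp (-(b - a)) := by
    rw [← Real.exp_add]; ring_nf
  have h3 := Real.add_one_le_exp (-(b - a))
  have h4 : Real.exp (-a) ≤ 1 := Real.exp_le_one_iff.2 (by linarith)
  rw [abs_of_nonneg (by linarith), abs_of_nonpos (by linarith), h2]
  nlinarith [Real.exp_pos (-a)]

/-- The term `4|t|³` is the cubic Taylor error, using `∑ |x_k|³ ≤ η ∑ x_k² ≤ 2η`; the term `t²/2` is
the cost of replacing `exp(-t² ∑ x_k² / 2)` by `exp(-t²/2)`. -/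
lemma norm_exp_sub_mcLeishProd_le_of_small {t η : ℝ} (hη : 0 < η) (hη1 : η ≤ 1)
    (htη : |t| * η ≤ 1) {x : ℕ → ℝ} {n : ℕ}
    (hQ : |∑ k ∈ Finset.range n, x k ^ 2 - 1| ≤ η) (hx : ∀ k < n, |x k| ≤ η) :
    ‖Complex.exp (Complex.I * ((t * ∑ k ∈ Finset.range n, x k : ℝ) : ℂ))
        - (Real.exp (-t ^ 2 / 2) : ℂ) * mcLeishProd t x n‖
      ≤ Real.exp (t ^ 2) * (4 * |t| ^ 3 + t ^ 2 / 2) * η := by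
  have hT := norm_mcLeishProd_le_exp t x n
  set Q := ∑ k ∈ Finset.range n, x k ^ 2 with hQdef
  have hQ0 : 0 ≤ Q := by positivity
  have hQ2 : Q ≤ 2 := by linarith [(abs_le.1 hQ).2]
  have hexp : Real.exp (t ^ 2 * Q / 2) ≤ Real.exp (t ^ 2) :=
    Real.exp_le_exp.2 (by nlinarith [sq_nonneg t])
  have hmain := norm_prod_exp_sub_le (Finset.range n) (fun k => t * x k) (fun k hk => by
    rw [abs_mul]
    exact (mul_le_mul_of_nonneg_left (hx k (Finset.mem_range.1 hk)) (abs_nonneg t)).trans htη)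
  have hs2 : ∑ k ∈ Finset.range n, (t * x k) ^ 2 = t ^ 2 * Q := by
    rw [hQdef, Finset.mul_sum]; simp only [mul_pow]
  have hs3 : ∑ k ∈ Finset.range n, |t * x k| ^ 3 ≤ |t| ^ 3 * η * Q := by
    rw [hQdef, Finset.mul_sum]
    refine Finset.sum_le_sum fun k hk => ?_
    rw [abs_mul, mul_pow, mul_assoc]
    gcongr
    rw [← sq_abs (x k)]
    have := hx k (Finset.mem_range.1 hk)
    nlinarith [sq_nonneg |x k|]
  have hexp2 : Complex.exp (-((t ^ 2 * Q : ℝ) : ℂ) / 2) = (Real.exp (-(t ^ 2 * Q / 2)) : ℂ) := by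
    push_cast; ring_nf
  rw [← mcLeishProd_eq_of_sum_le hQ2, ← Finset.mul_sum, hs2, hexp2] at hmain
  have hd := abs_exp_neg_sub_exp_neg_le (a := t ^ 2 * Q / 2) (b := t ^ 2 / 2) (by positivity)
    (by positivity)
  have hd' : |t ^ 2 * Q / 2 - t ^ 2 / 2| ≤ t ^ 2 / 2 * η := by
    rw [show t ^ 2 * Q / 2 - t ^ 2 / 2 = t ^ 2 / 2 * (Q - 1) by ring, abs_mul,
      abs_of_nonneg (by positivity : 0 ≤ t ^ 2 / 2)]
    gcongr
  set E := Complex.exp (Complex.I * ((t * ∑ k ∈ Finset.range n, x k : ℝ) : ℂ))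
  set Z := mcLeishProd t x n
  have e : E - (Real.exp (-t ^ 2 / 2) : ℂ) * Z
      = (E - Z * (Real.exp (-(t ^ 2 * Q / 2)) : ℂ))
        + Z * ((Real.exp (-(t ^ 2 * Q / 2)) - Real.exp (-(t ^ 2 / 2)) : ℝ) : ℂ) := by
    rw [neg_div]; push_cast; ring
  rw [e]
  refine (norm_add_le _ _).trans ?_
  rw [norm_mul, Complex.norm_real, Real.norm_eq_abs]
  have hsum : |t| ^ 3 * η * Q ≤ |t| ^ 3 * η * 2 := by gcongr
  calc _ ≤ 2 * Real.exp (t ^ 2) * (|t| ^ 3 * η * 2) + Real.exp (t ^ 2) * (t ^ 2 / 2 * η) := by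
        gcongr
        · refine hmain.trans ?_
          gcongr
          exact hs3.trans hsum
        · exact hT.trans hexp
        · exact hd.trans hd'
    _ = _ := by ring

lemma norm_exp_sub_mcLeishProd_le {t δ η : ℝ} (hδ : 0 < δ) (hη : 0 < η) (hη1 : η ≤ 1)
    (htη : |t| * η ≤ 1) (x : ℕ → ℝ) (n : ℕ) :
    ‖Complex.exp (Complex.I * ((t * ∑ k ∈ Finset.range n, x k : ℝ) : ℂ))
        - (Real.exp (-t ^ 2 / 2) : ℂ) * mcLeishProd t x n‖
      ≤ Real.exp (t ^ 2) * (4 * |t| ^ 3 + t ^ 2 / 2) * η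
        + (1 + Real.exp (t ^ 2) * (1 + |t|))
          * (if η < |∑ k ∈ Finset.range n, x k ^ 2 - 1| then 1 else 0)
        + ((1 + Real.exp (t ^ 2) * (1 + |t|)) / η ^ (2 + δ) + Real.exp (t ^ 2) * |t|)
          * ∑ k ∈ Finset.range n, |x k| ^ (2 + δ) := by
  set V := ∑ k ∈ Finset.range n, |x k| ^ (2 + δ) with hV
  have hV0 : 0 ≤ V := by positivity
  have hxV : ∀ k < n, |x k| ^ (2 + δ) ≤ V := fun k hk =>
    Finset.single_le_sum (f := fun k => |x k| ^ (2 + δ)) (fun _ _ => by positivity)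
      (Finset.mem_range.2 hk)
  have hηp : 0 < η ^ (2 + δ) := by positivity
  have hbase : 0 ≤ Real.exp (t ^ 2) * (4 * |t| ^ 3 + t ^ 2 / 2) * η := by positivity
  by_cases hG : |∑ k ∈ Finset.range n, x k ^ 2 - 1| ≤ η ∧ V ≤ η ^ (2 + δ)
  · have h1 := norm_exp_sub_mcLeishProd_le_of_small (t := t) hη hη1 htη hG.1 (fun k hk =>
      (Real.rpow_le_rpow_iff (abs_nonneg _) hη.le (by linarith)).1 ((hxV k hk).trans hG.2))
    refine h1.trans ?_
    rw [if_neg (not_lt.2 hG.1), add_assoc]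
    refine le_add_of_nonneg_right ?_
    positivity
  -- On the bad set only size matters: each `|x_k|` is at most `1` or at most `|x_k|^(2+δ) ≤ V`, so
  -- `m = 1 + V` works.
  · have hT := norm_mcLeishProd_le t x n (1 + V) (by positivity) (fun k hk => by
      by_cases h1 : |x k| ≤ 1
      · linarith
      · have := Real.rpow_le_rpow_of_exponent_le (le_of_not_ge h1) (by linarith : 1 ≤ 2 + δ)
        rw [Real.rpow_one] at this
        linarith [hxV k hk])
    have hone : (1 : ℝ) ≤ (if η < |∑ k ∈ Finset.range n, x k ^ 2 - 1| then 1 else 0)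
        + V / η ^ (2 + δ) := by
      split_ifs with h
      · have : 0 ≤ V / η ^ (2 + δ) := by positivity
        linarith
      · have : η ^ (2 + δ) < V := by
          by_contra h'
          exact hG ⟨not_lt.1 h, not_lt.1 h'⟩
        rw [zero_add, le_div_iff₀ hηp]
        linarith
    have hc : Real.exp (-t ^ 2 / 2) ≤ 1 := Real.exp_le_one_iff.2 (by nlinarith [sq_nonneg t])
    have hb : ‖Complex.exp (Complex.I * ((t * ∑ k ∈ Finset.range n, x k : ℝ) : ℂ))
        - (Real.exp (-t ^ 2 / 2) : ℂ) * mcLeishProd t x n‖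
        ≤ 1 + 1 * (Real.exp (t ^ 2) * (1 + |t| * (1 + V))) := by
      refine (norm_sub_le _ _).trans ?_
      rw [norm_mul, Complex.norm_real, Real.norm_of_nonneg (Real.exp_nonneg _)]
      refine add_le_add (le_of_eq ?_) (mul_le_mul hc hT (norm_nonneg _) zero_le_one)
      rw [Complex.norm_exp]; simp
    have hK : 0 ≤ 1 + Real.exp (t ^ 2) * (1 + |t|) := by positivity
    have := mul_le_mul_of_nonneg_left hone hK
    refine hb.trans ?_
    calc _ = (1 + Real.exp (t ^ 2) * (1 + |t|)) * 1 + Real.exp (t ^ 2) * |t| * V := by ring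
      _ ≤ 0 + (1 + Real.exp (t ^ 2) * (1 + |t|))
          * ((if η < |∑ k ∈ Finset.range n, x k ^ 2 - 1| then 1 else 0) + V / η ^ (2 + δ))
          + Real.exp (t ^ 2) * |t| * V := by rw [zero_add]; gcongr
      _ ≤ Real.exp (t ^ 2) * (4 * |t| ^ 3 + t ^ 2 / 2) * η + (1 + Real.exp (t ^ 2) * (1 + |t|))
          * ((if η < |∑ k ∈ Finset.range n, x k ^ 2 - 1| then 1 else 0) + V / η ^ (2 + δ))
          + Real.exp (t ^ 2) * |t| * V := by gcongr
      _ = _ := by ring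

lemma measurable_mcLeishProd {Ω : Type*} [MeasurableSpace Ω] (t : ℝ) {D : ℕ → Ω → ℝ} {n : ℕ}
    (hD : ∀ k < n, Measurable (D k)) :
    Measurable fun ω => mcLeishProd t (fun k => D k ω) n := by
  refine Finset.measurable_fun_prod _ fun k hk => ?_
  have hk := Finset.mem_range.1 hk
  refine measurable_const.add (measurable_const.mul (Complex.measurable_ofReal.comp ?_))
  refine measurable_const.mul (Measurable.ite ?_ (hD k hk) measurable_const)
  refine measurableSet_le (Finset.measurable_fun_sum _ fun j hj => ?_) measurable_const
  exact (hD j ((Finset.mem_range.1 hj).trans hk)).pow_const 2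

/-! ### Expectation of McLeish's product and the characteristic function -/

section Martingale

variable {Ω : Type*} {m : MeasurableSpace Ω} {μ : Measure Ω} [IsProbabilityMeasure μ]
  {ℱ : Filtration ℕ m} {D : ℕ → Ω → ℝ}

lemma integral_smul_eq_zero_of_condExp_eq_zero {m₀ : MeasurableSpace Ω} (hm : m₀ ≤ m)
    {W : Ω → ℂ} (hW : StronglyMeasurable[m₀] W) {c : ℝ} (hc : ∀ ω, ‖W ω‖ ≤ c) {d : Ω → ℝ}
    (hd : Integrable d μ) (h0 : μ[d | m₀] =ᵐ[μ] 0) : ∫ ω, d ω • W ω ∂μ = 0 := by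
  have h := condExp_stronglyMeasurable_bilin_of_bound (μ := μ)
    (ContinuousLinearMap.lsmul ℝ ℝ : ℝ →L[ℝ] ℂ →L[ℝ] ℂ).flip hm hW hd c (ae_of_all _ hc)
  simp only [ContinuousLinearMap.flip_apply, ContinuousLinearMap.lsmul_apply] at h
  rw [← integral_condExp hm, integral_congr_ae h]
  refine integral_eq_zero_of_ae ?_
  filter_upwards [h0] with ω hω
  simp [hω]

lemma integrable_mcLeishProd (t : ℝ) {n : ℕ} (hint : ∀ k < n, Integrable (D k) μ)
    (hmeas : ∀ k < n, Measurable (D k)) :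
    Integrable (fun ω => mcLeishProd t (fun k => D k ω) n) μ := by
  have hb : Integrable (fun ω => Real.exp (t ^ 2) *
      (1 + |t| * ∑ k ∈ Finset.range n, |D k ω|)) μ := by
    refine ((integrable_const _).add (Integrable.const_mul ?_ _)).const_mul _
    exact integrable_finsetSum _ fun k hk => (hint k (Finset.mem_range.1 hk)).abs
  refine hb.mono' (measurable_mcLeishProd t hmeas).aestronglyMeasurable (ae_of_all _ fun ω => ?_)
  refine norm_mcLeishProd_le t _ n _ (by positivity) fun k hk => ?_
  exact Finset.single_le_sum (f := fun k => |D k ω|) (fun _ _ => abs_nonneg _)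
    (Finset.mem_range.2 hk)

/-- Each new factor adds `D_n` times an `F_n`-measurable weight, and this has mean zero. The switch
at `2` keeps the weight bounded by `|t| e^{t²}`, so integrability of `D_n` is enough. -/
lemma integral_mcLeishProd (t : ℝ) (n : ℕ) (hint : ∀ k < n, Integrable (D k) μ)
    (hmeas : ∀ k, Measurable[ℱ (k + 1)] (D k)) (h0 : ∀ k < n, μ[D k | ℱ k] =ᵐ[μ] 0) :
    ∫ ω, mcLeishProd t (fun k => D k ω) n ∂μ = 1 := by
  have hmeas' : ∀ k, Measurable (D k) := fun k => (hmeas k).mono (ℱ.le _) le_rfl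
  induction n with
  | zero => simp [mcLeishProd]
  | succ n ih =>
    have hmeasn : ∀ k < n, Measurable[ℱ n] (D k) := fun k hk =>
      (hmeas k).mono (ℱ.mono (by omega)) le_rfl
    let W : Ω → ℂ := fun ω => if ∑ j ∈ Finset.range n, D j ω ^ 2 ≤ 2 then
      Complex.I * t * mcLeishProd t (fun k => D k ω) n else 0
    have hWm : Measurable[ℱ n] W := by
      have hQ : Measurable[ℱ n] fun ω => ∑ j ∈ Finset.range n, D j ω ^ 2 :=
        Finset.measurable_fun_sum _ fun j hj =>
          (hmeasn j (Finset.mem_range.1 hj)).pow_const 2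
      exact Measurable.ite (hQ measurableSet_Iic)
        ((@measurable_mcLeishProd Ω (ℱ n) t D n hmeasn).const_mul _) measurable_const
    have hWb : ∀ ω, ‖W ω‖ ≤ |t| * Real.exp (t ^ 2) := by
      intro ω
      simp only [W]
      split_ifs with h
      · rw [norm_mul, norm_mul, Complex.norm_I, one_mul, Complex.norm_real, Real.norm_eq_abs]
        gcongr
        refine (norm_mcLeishProd_le_exp t _ n).trans (Real.exp_le_exp.2 ?_)
        nlinarith [sq_nonneg t]
      · simp; positivity
    have hz := integral_smul_eq_zero_of_condExp_eq_zero (ℱ.le n) hWm.stronglyMeasurable hWb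
      (hint n (by simp)) (h0 n (by simp))
    have hsplit : ∀ ω, mcLeishProd t (fun k => D k ω) (n + 1)
        = mcLeishProd t (fun k => D k ω) n + D n ω • W ω := by
      intro ω
      rw [mcLeishProd, Finset.prod_range_succ, ← mcLeishProd]
      simp only [W]
      split_ifs
      · rw [Complex.real_smul]; push_cast; ring
      · simp
    simp only [hsplit]
    rw [integral_add, hz, add_zero]
    · exact ih (fun k hk => hint k (by omega)) (fun k hk => h0 k (by omega))
    · exact integrable_mcLeishProd t (fun k hk => hint k (by omega)) fun k _ => hmeas' k
    · refine (hint n (by simp)).smul_bdd (|t| * Real.exp (t ^ 2))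
        (hWm.mono (ℱ.le _) le_rfl).aestronglyMeasurable ?_
      exact ae_of_all _ hWb

lemma norm_charFun_sub_le {t δ η : ℝ} (hδ : 0 < δ) (hη : 0 < η) (hη1 : η ≤ 1)
    (htη : |t| * η ≤ 1) (n : ℕ)
    (hint : ∀ k < n, Integrable (fun ω => |D k ω| ^ (2 + δ)) μ)
    (hmeas : ∀ k, Measurable[ℱ (k + 1)] (D k)) (h0 : ∀ k < n, μ[D k | ℱ k] =ᵐ[μ] 0) :
    ‖∫ ω, Complex.exp (Complex.I * ((t * ∑ k ∈ Finset.range n, D k ω : ℝ) : ℂ)) ∂μ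
        - (Real.exp (-t ^ 2 / 2) : ℂ)‖
      ≤ Real.exp (t ^ 2) * (4 * |t| ^ 3 + t ^ 2 / 2) * η
        + (1 + Real.exp (t ^ 2) * (1 + |t|))
          * μ.real {ω | η < |∑ k ∈ Finset.range n, D k ω ^ 2 - 1|}
        + ((1 + Real.exp (t ^ 2) * (1 + |t|)) / η ^ (2 + δ) + Real.exp (t ^ 2) * |t|)
          * ∑ k ∈ Finset.range n, ∫ ω, |D k ω| ^ (2 + δ) ∂μ := by
  have hmeas' : ∀ k, Measurable (D k) := fun k => (hmeas k).mono (ℱ.le _) le_rfl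
  have hint1 : ∀ k < n, Integrable (D k) μ := by
    intro k hk
    refine ((integrable_const (1 : ℝ)).add (hint k hk)).mono' (hmeas' k).aestronglyMeasurable
      (ae_of_all _ fun ω => ?_)
    rw [Real.norm_eq_abs, Pi.add_apply]
    by_cases h1 : |D k ω| ≤ 1
    · have : 0 ≤ |D k ω| ^ (2 + δ) := by positivity
      linarith
    · have := Real.rpow_le_rpow_of_exponent_le (le_of_not_ge h1) (by linarith : 1 ≤ 2 + δ)
      rw [Real.rpow_one] at this
      linarith
  have hT := integrable_mcLeishProd (μ := μ) t hint1 fun k _ => hmeas' k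
  have hS : Measurable fun ω => ∑ k ∈ Finset.range n, D k ω :=
    Finset.measurable_fun_sum _ fun k _ => hmeas' k
  have hE : Integrable (fun ω =>
      Complex.exp (Complex.I * ((t * ∑ k ∈ Finset.range n, D k ω : ℝ) : ℂ))) μ := by
    refine Integrable.of_bound (by fun_prop) 1 (ae_of_all _ fun ω => ?_)
    rw [Complex.norm_exp]; simp
  have hset : MeasurableSet {ω | η < |∑ k ∈ Finset.range n, D k ω ^ 2 - 1|} := by
    refine measurableSet_lt measurable_const ?_
    have : Measurable fun ω => ∑ k ∈ Finset.range n, D k ω ^ 2 :=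
      Finset.measurable_fun_sum _ fun k _ => (hmeas' k).pow_const 2
    fun_prop
  have hV : Integrable (fun ω => ∑ k ∈ Finset.range n, |D k ω| ^ (2 + δ)) μ :=
    integrable_finsetSum _ fun k hk => hint k (Finset.mem_range.1 hk)
  have hI : Integrable (fun ω =>
      if η < |∑ k ∈ Finset.range n, D k ω ^ 2 - 1| then (1 : ℝ) else 0) μ := by
    exact (integrable_const (μ := μ) (1 : ℝ)).indicator hset
  have hIint : ∫ ω, (if η < |∑ k ∈ Finset.range n, D k ω ^ 2 - 1| then (1 : ℝ) else 0) ∂μ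
      = μ.real {ω | η < |∑ k ∈ Finset.range n, D k ω ^ 2 - 1|} := by
    rw [← integral_indicator_one hset]
    rfl
  have h1 := integral_mcLeishProd t n hint1 hmeas h0
  have e : ∫ ω, Complex.exp (Complex.I * ((t * ∑ k ∈ Finset.range n, D k ω : ℝ) : ℂ)) ∂μ
        - (Real.exp (-t ^ 2 / 2) : ℂ)
      = ∫ ω, (Complex.exp (Complex.I * ((t * ∑ k ∈ Finset.range n, D k ω : ℝ) : ℂ))
        - (Real.exp (-t ^ 2 / 2) : ℂ) * mcLeishProd t (fun k => D k ω) n) ∂μ := by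
    rw [integral_sub hE (hT.const_mul _), integral_const_mul, h1, mul_one]
  rw [e]
  refine (norm_integral_le_of_norm_le ?_ (ae_of_all _ fun ω =>
    norm_exp_sub_mcLeishProd_le hδ hη hη1 htη (fun k => D k ω) n)).trans (le_of_eq ?_)
  · exact ((integrable_const _).add (hI.const_mul _)).add (hV.const_mul _)
  · have hcI : Integrable (fun ω => Real.exp (t ^ 2) * (4 * |t| ^ 3 + t ^ 2 / 2) * η
        + (1 + Real.exp (t ^ 2) * (1 + |t|))
          * (if η < |∑ k ∈ Finset.range n, D k ω ^ 2 - 1| then (1 : ℝ) else 0)) μ :=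
      (integrable_const _).add (hI.const_mul _)
    rw [integral_add hcI (hV.const_mul _),
      integral_add (integrable_const _) (hI.const_mul _), integral_const, integral_const_mul,
      integral_const_mul, hIint, integral_finsetSum _ fun k hk => hint k (Finset.mem_range.1 hk)]
    simp

end Martingale

/-- **Martingale central limit theorem** for triangular arrays under a Lyapunov condition. -/
theorem tendstoInDistribution_sum_martingaleDiff
    {Ω : ℕ → Type*} [mΩ : ∀ T, MeasurableSpace (Ω T)]
    (μ : ∀ T, Measure (Ω T)) [∀ T, IsProbabilityMeasure (μ T)]
    (ℱ : ∀ T, Filtration ℕ (mΩ T)) (D : ∀ T, ℕ → Ω T → ℝ) (n : ℕ → ℕ)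
    (hmeas : ∀ T k, Measurable[ℱ T (k + 1)] (D T k)) {δ : ℝ} (hδ : 0 < δ)
    (hint : ∀ᶠ T in atTop, ∀ k < n T, Integrable (fun ω => |D T k ω| ^ (2 + δ)) (μ T))
    (h0 : ∀ᶠ T in atTop, ∀ k < n T, (μ T)[D T k | ℱ T k] =ᵐ[μ T] 0)
    (hLyap : Tendsto (fun T => ∑ k ∈ Finset.range (n T), ∫ ω, |D T k ω| ^ (2 + δ) ∂(μ T))
      atTop (𝓝 0))
    (hQ : ∀ η : ℝ, 0 < η → Tendsto (fun T =>
      μ T {ω | η < |∑ k ∈ Finset.range (n T), D T k ω ^ 2 - 1|}) atTop (𝓝 0)) :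
    TendstoInDistribution (fun T ω => ∑ k ∈ Finset.range (n T), D T k ω) atTop
      (id : ℝ → ℝ) μ (gaussianReal 0 1) := by
  have hmeas' : ∀ T k, Measurable (D T k) := fun T k => (hmeas T k).mono ((ℱ T).le _) le_rfl
  have hS : ∀ T, Measurable fun ω => ∑ k ∈ Finset.range (n T), D T k ω := fun T =>
    Finset.measurable_fun_sum _ fun k _ => hmeas' T k
  refine ⟨fun T => (hS T).aemeasurable, aemeasurable_id, ?_⟩
  refine ProbabilityMeasure.tendsto_iff_tendsto_charFun.2 fun t => ?_
  have hlim : charFun ((gaussianReal 0 1).map id) t = (Real.exp (-t ^ 2 / 2) : ℂ) := by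
    rw [Measure.map_id, charFun_gaussianReal]
    push_cast
    congr 1
    simp
    ring
  have hchar : ∀ T, charFun ((μ T).map fun ω => ∑ k ∈ Finset.range (n T), D T k ω) t
      = ∫ ω, Complex.exp (Complex.I * ((t * ∑ k ∈ Finset.range (n T), D T k ω : ℝ) : ℂ))
          ∂(μ T) := by
    intro T
    rw [charFun_apply_real, integral_map (hS T).aemeasurable (by fun_prop)]
    congr with ω
    congr 1
    push_cast
    ring
  simp only [ProbabilityMeasure.coe_mk, hlim, hchar]
  set K := Real.exp (t ^ 2) * (4 * |t| ^ 3 + t ^ 2 / 2)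
  rw [Metric.tendsto_atTop']
  intro ε hε
  -- The level `η` is fixed before `T → ∞`: `K η` is the only part of the bound that does not vanish
  -- in the limit.
  obtain ⟨η, hη, hη1, htη, hKη⟩ : ∃ η : ℝ, 0 < η ∧ η ≤ 1 ∧ |t| * η ≤ 1 ∧ K * η < ε := by
    have h1 : ∀ᶠ η in 𝓝[>] (0 : ℝ), |t| * η < 1 :=
      (tendsto_nhdsWithin_of_tendsto_nhds ((continuous_const.mul continuous_id).tendsto' 0 0
        (by simp))).eventually_lt_const one_pos
    have h2 : ∀ᶠ η in 𝓝[>] (0 : ℝ), K * η < ε :=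
      (tendsto_nhdsWithin_of_tendsto_nhds ((continuous_const.mul continuous_id).tendsto' 0 0
        (by simp))).eventually_lt_const hε
    have h3 : ∀ᶠ η in 𝓝[>] (0 : ℝ), η < 1 :=
      (tendsto_nhdsWithin_of_tendsto_nhds tendsto_id).eventually_lt_const one_pos
    obtain ⟨η, a, b, c, d⟩ := (h1.and (h2.and (h3.and self_mem_nhdsWithin))).exists
    exact ⟨η, d, c.le, a.le, b⟩
  have hreal : Tendsto (fun T => (μ T).real
      {ω | η < |∑ k ∈ Finset.range (n T), D T k ω ^ 2 - 1|}) atTop (𝓝 0) := by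
    simpa [Measure.real, Function.comp_def] using
      (ENNReal.tendsto_toReal ENNReal.zero_ne_top).comp (hQ η hη)
  have hbound := ((tendsto_const_nhds (x := K * η)).add (hreal.const_mul
    (1 + Real.exp (t ^ 2) * (1 + |t|)))).add (hLyap.const_mul
    ((1 + Real.exp (t ^ 2) * (1 + |t|)) / η ^ (2 + δ) + Real.exp (t ^ 2) * |t|))
  simp only [mul_zero, add_zero] at hbound
  have hev := (hbound.eventually_lt_const hKη).and (hint.and h0)
  obtain ⟨N, hN⟩ := eventually_atTop.1 hev
  refine ⟨N, fun T hT => ?_⟩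
  obtain ⟨ha, hb, hc⟩ := hN T hT.le
  rw [dist_eq_norm]
  exact (norm_charFun_sub_le hδ hη hη1 htη (n T) hb (hmeas T) hc).trans_lt ha

/-! ### Slutsky's theorem on varying probability spaces -/

section Slutsky

lemma TendstoInDistribution.congr_eventually {Ω : ℕ → Type*} [∀ T, MeasurableSpace (Ω T)]
    {μ : ∀ T, Measure (Ω T)} [∀ T, IsProbabilityMeasure (μ T)]
    {Ω' : Type*} [MeasurableSpace Ω'] {μ' : Measure Ω'} [IsProbabilityMeasure μ']
    {X Y : ∀ T, Ω T → ℝ} {Z : Ω' → ℝ}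
    (hX : TendstoInDistribution X atTop Z μ μ') (hY : ∀ T, AEMeasurable (Y T) (μ T))
    (h : ∀ᶠ T in atTop, X T =ᵐ[μ T] Y T) : TendstoInDistribution Y atTop Z μ μ' := by
  refine ⟨hY, hX.aemeasurable_limit, hX.tendsto.congr' ?_⟩
  filter_upwards [h] with T hT
  exact Subtype.ext (Measure.map_congr hT)

/-- Slutsky's theorem for a product, the variables living on varying probability spaces. -/
theorem TendstoInDistribution.mul_of_tendsto_one {Ω : ℕ → Type*} [∀ T, MeasurableSpace (Ω T)]
    {μ : ∀ T, Measure (Ω T)} [∀ T, IsProbabilityMeasure (μ T)]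
    {Ω' : Type*} [MeasurableSpace Ω'] {μ' : Measure Ω'} [IsProbabilityMeasure μ']
    {S W : ∀ T, Ω T → ℝ} {Z : Ω' → ℝ} (hS : TendstoInDistribution S atTop Z μ μ')
    (hSm : ∀ T, Measurable (S T)) (hWm : ∀ T, Measurable (W T))
    (hW : ∀ ε : ℝ, 0 < ε → Tendsto (fun T => μ T {ω | ε ≤ |W T ω - 1|}) atTop (𝓝 0)) :
    TendstoInDistribution (fun T ω => S T ω * W T ω) atTop Z μ μ' := by
  -- Convergence in distribution sees only the law for each `T`, so all the spaces may be coupled as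
  -- coordinates of one product space, where the Slutsky theorem for a common space applies.
  have hmp : ∀ T, MeasurePreserving (Function.eval T) (Measure.infinitePi μ) (μ T) :=
    measurePreserving_eval_infinitePi μ
  have hmap : ∀ (f : ∀ T, Ω T → ℝ), (∀ T, Measurable (f T)) → ∀ T,
      (Measure.infinitePi μ).map (fun ω => f T (ω T)) = (μ T).map (f T) := by
    intro f hf T
    rw [← (hmp T).map_eq, Measure.map_map (hf T) (hmp T).measurable]
    rfl
  have hS' : TendstoInDistribution (fun T (ω : ∀ T, Ω T) => S T (ω T)) atTop Z
      (fun _ => Measure.infinitePi μ) μ' := by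
    refine ⟨fun T => ((hSm T).comp (measurable_pi_apply T)).aemeasurable,
      hS.aemeasurable_limit, hS.tendsto.congr fun T => Subtype.ext ?_⟩
    exact (hmap S hSm T).symm
  have hW' : TendstoInMeasure (Measure.infinitePi μ) (fun T (ω : ∀ T, Ω T) => W T (ω T)) atTop
      (fun _ => (1 : ℝ)) := by
    rw [tendstoInMeasure_iff_norm]
    intro ε hε
    refine (hW ε hε).congr fun T => ?_
    have hms : MeasurableSet {ω | ε ≤ |W T ω - 1|} :=
      measurableSet_le measurable_const (by have := hWm T; fun_prop)
    rw [← (hmp T).measure_preimage hms.nullMeasurableSet]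
    rfl
  have h := hS'.continuous_comp_prodMk_of_tendstoInMeasure_const
    (g := fun x : ℝ × ℝ => x.1 * x.2) (by fun_prop) hW'
    fun T => ((hWm T).comp (measurable_pi_apply T)).aemeasurable
  simp only [mul_one] at h
  refine ⟨fun T => ((hSm T).mul (hWm T)).aemeasurable, hS.aemeasurable_limit,
    h.tendsto.congr fun T => Subtype.ext ?_⟩
  exact hmap (fun T ω => S T ω * W T ω) (fun T => (hSm T).mul (hWm T)) T

end Slutsky

/-- **Martingale central limit theorem**, self-normalized. -/
theorem tendstoInDistribution_selfNormalized_martingaleDiff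
    {Ω : ℕ → Type*} [mΩ : ∀ T, MeasurableSpace (Ω T)]
    (μ : ∀ T, Measure (Ω T)) [∀ T, IsProbabilityMeasure (μ T)]
    (ℱ : ∀ T, Filtration ℕ (mΩ T)) (D : ∀ T, ℕ → Ω T → ℝ) (n : ℕ → ℕ)
    (hmeas : ∀ T k, Measurable[ℱ T (k + 1)] (D T k)) {δ : ℝ} (hδ : 0 < δ)
    (hint : ∀ᶠ T in atTop, ∀ k < n T, Integrable (fun ω => |D T k ω| ^ (2 + δ)) (μ T))
    (h0 : ∀ᶠ T in atTop, ∀ k < n T, (μ T)[D T k | ℱ T k] =ᵐ[μ T] 0)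
    (hLyap : Tendsto (fun T => ∑ k ∈ Finset.range (n T), ∫ ω, |D T k ω| ^ (2 + δ) ∂(μ T))
      atTop (𝓝 0))
    (hQ : ∀ η : ℝ, 0 < η → Tendsto (fun T =>
      μ T {ω | η < |∑ k ∈ Finset.range (n T), D T k ω ^ 2 - 1|}) atTop (𝓝 0)) :
    TendstoInDistribution (fun T ω => (∑ k ∈ Finset.range (n T), D T k ω)
        * (√(∑ k ∈ Finset.range (n T), D T k ω ^ 2))⁻¹) atTop
      (id : ℝ → ℝ) μ (gaussianReal 0 1) := by
  have hmeas' : ∀ T k, Measurable (D T k) := fun T k => (hmeas T k).mono ((ℱ T).le _) le_rfl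
  have hcont : Tendsto (fun q : ℝ => (√q)⁻¹) (𝓝 1) (𝓝 1) := by
    have : ContinuousAt (fun q : ℝ => (√q)⁻¹) 1 :=
      Real.continuous_sqrt.continuousAt.inv₀ (by simp)
    simpa [ContinuousAt] using this
  refine TendstoInDistribution.mul_of_tendsto_one
    (tendstoInDistribution_sum_martingaleDiff μ ℱ D n hmeas hδ hint h0 hLyap hQ)
    (fun T => Finset.measurable_fun_sum _ fun k _ => hmeas' T k)
    (fun T => (Finset.measurable_fun_sum _ fun k _ => (hmeas' T k).pow_const 2).sqrt.inv)
    fun ε hε => ?_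
  obtain ⟨η, hη, hηε⟩ := Metric.tendsto_nhds_nhds.1 hcont ε hε
  refine tendsto_of_tendsto_of_tendsto_of_le_of_le tendsto_const_nhds (hQ (η / 2) (by positivity))
    (fun _ => zero_le) fun T => measure_mono fun ω hω => ?_
  by_contra h
  have := hηε (x := ∑ k ∈ Finset.range (n T), D T k ω ^ 2) (by
    rw [Real.dist_eq]
    have : ¬ (η / 2 < |∑ k ∈ Finset.range (n T), D T k ω ^ 2 - 1|) := h
    linarith)
  rw [Real.dist_eq] at this
  exact absurd hω (not_le.2 this)

/-! ### Quadratic forms, Euclidean norm and smallest eigenvalue -/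

/-- The quadratic form `θ' M θ`. -/
noncomputable def quadForm {p : ℕ} (M : Matrix (Fin p) (Fin p) ℝ) (θ : EuclideanSpace ℝ (Fin p)) :
    ℝ := ∑ i, ∑ j, θ i * M i j * θ j

section QuadForm

variable {p : ℕ}

lemma quadForm_sub (M N : Matrix (Fin p) (Fin p) ℝ) (θ : EuclideanSpace ℝ (Fin p)) :
    quadForm (M - N) θ = quadForm M θ - quadForm N θ := by
  simp only [quadForm, Matrix.sub_apply, mul_sub, sub_mul, Finset.sum_sub_distrib]

lemma quadForm_smul (c : ℝ) (M : Matrix (Fin p) (Fin p) ℝ) (θ : EuclideanSpace ℝ (Fin p)) :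
    quadForm (c • M) θ = c * quadForm M θ := by
  simp only [quadForm, Matrix.smul_apply, smul_eq_mul, Finset.mul_sum]
  exact Finset.sum_congr rfl fun i _ => Finset.sum_congr rfl fun j _ => by ring

lemma quadForm_sum {ι : Type*} (s : Finset ι) (M : ι → Matrix (Fin p) (Fin p) ℝ)
    (θ : EuclideanSpace ℝ (Fin p)) :
    quadForm (∑ t ∈ s, M t) θ = ∑ t ∈ s, quadForm (M t) θ := by
  classical
  induction s using Finset.induction_on with
  | empty => simp [quadForm]
  | insert a s ha ih =>
    rw [Finset.sum_insert ha, Finset.sum_insert ha, ← ih]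
    simp only [quadForm, Matrix.add_apply, mul_add, add_mul, Finset.sum_add_distrib]

lemma quadForm_outer (x θ : EuclideanSpace ℝ (Fin p)) :
    quadForm (outer x) θ = (inner ℝ x θ) ^ 2 := by
  rw [sq, PiLp.inner_apply, Finset.sum_mul_sum, quadForm]
  refine Finset.sum_congr rfl fun i _ => Finset.sum_congr rfl fun j _ => ?_
  simp [outer]
  ring

/-- Cauchy–Schwarz over the index pairs `(i, j)`. -/
lemma abs_quadForm_le (M : Matrix (Fin p) (Fin p) ℝ) (θ : EuclideanSpace ℝ (Fin p)) :
    |quadForm M θ| ≤ euclNorm M * ‖θ‖ ^ 2 := by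
  have h1 : quadForm M θ = ∑ q : Fin p × Fin p, M q.1 q.2 * (θ q.1 * θ q.2) := by
    rw [quadForm, ← Finset.univ_product_univ, Finset.sum_product]
    exact Finset.sum_congr rfl fun i _ => Finset.sum_congr rfl fun j _ => by ring
  have h2 : (M.transpose * M).trace = ∑ q : Fin p × Fin p, M q.1 q.2 ^ 2 := by
    rw [← Finset.univ_product_univ, Finset.sum_product_right]
    simp [Matrix.trace, Matrix.mul_apply, sq]
  have h3 : ∑ q : Fin p × Fin p, (θ q.1 * θ q.2) ^ 2 = (‖θ‖ ^ 2) ^ 2 := by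
    rw [← Finset.univ_product_univ, Finset.sum_product, EuclideanSpace.real_norm_sq_eq, sq,
      Finset.sum_mul_sum]
    simp only [mul_pow]
  have h4 := Finset.sum_mul_sq_le_sq_mul_sq Finset.univ (fun q : Fin p × Fin p => M q.1 q.2)
    (fun q => θ q.1 * θ q.2)
  rw [← h1, ← h2, h3] at h4
  refine abs_le_of_sq_le_sq ?_ (by unfold euclNorm; positivity)
  rw [euclNorm, mul_pow, Real.sq_sqrt]
  · exact h4
  · rw [h2]; positivity

/-- Subtracting `λ_min` times the identity shifts the spectrum to the nonnegative half-line. -/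
lemma lambdaMin_mul_le_quadForm {M : Matrix (Fin p) (Fin p) ℝ} (hM : M.IsHermitian)
    (θ : EuclideanSpace ℝ (Fin p)) : lambdaMin M * ‖θ‖ ^ 2 ≤ quadForm M θ := by
  have hps : (M - lambdaMin M • (1 : Matrix (Fin p) (Fin p) ℝ)).PosSemidef := by
    have hH : (M - lambdaMin M • (1 : Matrix (Fin p) (Fin p) ℝ)).IsHermitian :=
      hM.sub (by simp [Matrix.IsHermitian])
    rw [hH.posSemidef_iff_eigenvalues_nonneg]
    intro i
    have hmem := hH.eigenvalues_mem_spectrum_real i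
    have hmem' : hH.eigenvalues i + lambdaMin M ∈ spectrum ℝ M := by
      rw [spectrum.mem_iff] at hmem ⊢
      rwa [Algebra.algebraMap_eq_smul_one, add_smul, ← sub_sub_eq_add_sub,
        ← Algebra.algebraMap_eq_smul_one]
    have hfin : (spectrum ℝ M).Finite := by
      rw [hM.spectrum_real_eq_range_eigenvalues]; exact Set.finite_range _
    have := csInf_le hfin.bddBelow hmem'
    simp only [Pi.zero_apply]
    have e : lambdaMin M = sInf (spectrum ℝ M) := rfl
    linarith
  have h := hps.re_dotProduct_nonneg θ.ofLp
  have e : dotProduct (star θ.ofLp)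
      ((M - lambdaMin M • (1 : Matrix (Fin p) (Fin p) ℝ)).mulVec θ.ofLp)
      = quadForm M θ - lambdaMin M * ‖θ‖ ^ 2 := by
    rw [Matrix.sub_mulVec, dotProduct_sub, Matrix.smul_mulVec, Matrix.one_mulVec,
      dotProduct_smul, EuclideanSpace.real_norm_sq_eq]
    simp [dotProduct, Matrix.mulVec, quadForm, Finset.mul_sum, mul_assoc, sq]
  rw [e] at h
  simp at h
  linarith

lemma measurable_quadForm (M : Matrix (Fin p) (Fin p) ℝ) : Measurable (quadForm M) := by
  unfold quadForm
  fun_prop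

end QuadForm

lemma sum_Ioc_natCast {E : Type*} [AddCommMonoid E] (R T : ℕ) (g : ℤ → E) :
    ∑ t ∈ Finset.Ioc (R : ℤ) (T : ℤ), g t = ∑ k ∈ Finset.range (T - R), g (R + k + 1) := by
  symm
  refine Finset.sum_nbij' (fun k : ℕ => (R : ℤ) + k + 1) (fun t => (t - R - 1).toNat) ?_ ?_ ?_ ?_ ?_
  · intro k hk; simp at hk ⊢; omega
  · intro t ht; simp at ht ⊢; omega
  · intro k hk; simp; omega
  · intro t ht; simp at ht; omega
  · intro k hk; rfl

/-! ### The array of normalized martingale differences -/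

section Sample

variable {Ω : Type*} {m : MeasurableSpace Ω} {p : ℕ} {Y : ℤ → Ω → ℝ}
  {X : ℤ → Ω → EuclideanSpace ℝ (Fin p)}

lemma comap_le_sigmaZ {S : Set ℤ} {s : ℤ} (hs : s ∈ S) :
    MeasurableSpace.comap (fun ω => (Y s ω, X s ω)) inferInstance ≤ sigmaZ Y X S :=
  le_iSup₂_of_le s hs le_rfl

lemma sigmaZ_mono {S S' : Set ℤ} (h : S ⊆ S') : sigmaZ Y X S ≤ sigmaZ Y X S' :=
  biSup_mono h

lemma sigmaZ_le (hY : ∀ t, Measurable (Y t)) (hX : ∀ t, Measurable (X t)) (S : Set ℤ) :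
    sigmaZ Y X S ≤ m :=
  iSup₂_le fun s _ => ((hY s).prodMk (hX s)).comap_le

lemma measurable_sigmaPast_fst (t : ℤ) : Measurable[sigmaPast Y X t] (Y t) := by
  have h : Measurable[sigmaPast Y X t] fun ω => (Y t ω, X t ω) :=
    Measurable.of_comap_le (comap_le_sigmaZ Set.self_mem_Iic)
  exact measurable_fst.comp h

/-- The filtration `F_{R + k}`, `k ∈ ℕ`. -/
def pastFiltration (hY : ∀ t, Measurable (Y t)) (hX : ∀ t, Measurable (X t)) (R : ℕ) :
    Filtration ℕ m where
  seq k := sigmaPast Y X (R + k)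
  mono' i j hij := sigmaZ_mono (Set.Iic_subset_Iic.2 (by simpa using hij))
  le' k := sigmaZ_le hY hX _

lemma matA_isHermitian (μ : Measure Ω) : (matA μ Y X).IsHermitian := by
  ext i j
  simp only [matA, matrixMean, Matrix.conjTranspose_apply, Matrix.of_apply, outer,
    Matrix.smul_apply, star_trivial]
  congr with ω
  rw [mul_comm (X 1 ω j)]

lemma quadForm_matAhat (R T : ℕ) (ω : Ω) (θ : EuclideanSpace ℝ (Fin p)) :
    quadForm (matAhat Y X R T ω) θ
      = outMean R T fun t => (Y t ω * inner ℝ (X t ω) θ) ^ 2 := by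
  simp only [matAhat, outMean, quadForm_smul, quadForm_sum, quadForm_outer, mul_pow, smul_eq_mul]

/-- The normalized martingale differences `Y_t X_t'θ̂ / √(P θ̂'Aθ̂)`, `t = R + k + 1`. -/
noncomputable def normDiff (μ : Measure Ω) (Y : ℤ → Ω → ℝ) (X : ℤ → Ω → EuclideanSpace ℝ (Fin p))
    (θ : Ω → EuclideanSpace ℝ (Fin p)) (R T : ℕ) (k : ℕ) (ω : Ω) : ℝ :=
  inner ℝ (X (R + k + 1) ω) (θ ω) / (√((T - R : ℕ) : ℝ) * √(quadForm (matA μ Y X) (θ ω)))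
    * Y (R + k + 1) ω

variable {μ : Measure Ω} {θ : Ω → EuclideanSpace ℝ (Fin p)} {R T : ℕ}

lemma sum_normDiff (ω : Ω) :
    ∑ k ∈ Finset.range (T - R), normDiff μ Y X θ R T k ω
      = √((T - R : ℕ) : ℝ) * outMean R T (fun t => Y t ω * inner ℝ (X t ω) (θ ω))
        / √(quadForm (matA μ Y X) (θ ω)) := by
  rw [outMean, sum_Ioc_natCast, smul_eq_mul, Finset.mul_sum, Finset.mul_sum, Finset.sum_div]
  refine Finset.sum_congr rfl fun k hk => ?_
  have hP : 0 < T - R := (Nat.zero_le k).trans_lt (Finset.mem_range.1 hk)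
  have hP' : (0 : ℝ) < ((T - R : ℕ) : ℝ) := by exact_mod_cast hP
  have e : ((T - R : ℕ) : ℝ)⁻¹ = (√((T - R : ℕ) : ℝ))⁻¹ * (√((T - R : ℕ) : ℝ))⁻¹ := by
    rw [← mul_inv, Real.mul_self_sqrt hP'.le]
  have hs : √((T - R : ℕ) : ℝ) ≠ 0 := (Real.sqrt_pos.2 hP').ne'
  rw [normDiff, e]
  field_simp

lemma sum_normDiff_sq (ω : Ω) (hq : 0 ≤ quadForm (matA μ Y X) (θ ω)) :
    ∑ k ∈ Finset.range (T - R), normDiff μ Y X θ R T k ω ^ 2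
      = quadForm (matAhat Y X R T ω) (θ ω) / quadForm (matA μ Y X) (θ ω) := by
  rw [quadForm_matAhat, outMean, sum_Ioc_natCast, smul_eq_mul, Finset.mul_sum, Finset.sum_div]
  refine Finset.sum_congr rfl fun k hk => ?_
  rw [normDiff, mul_pow, div_pow, mul_pow √((T - R : ℕ) : ℝ), Real.sq_sqrt (by positivity),
    Real.sq_sqrt hq]
  field_simp

lemma tStat_eq (ω : Ω) (hq : 0 < quadForm (matA μ Y X) (θ ω)) :
    (∑ k ∈ Finset.range (T - R), normDiff μ Y X θ R T k ω)
      * (√(∑ k ∈ Finset.range (T - R), normDiff μ Y X θ R T k ω ^ 2))⁻¹ = tStat Y X θ R T ω := by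
  rw [sum_normDiff_sq ω hq.le, sum_normDiff, tStat, ← quadForm_matAhat, Real.sqrt_div' _ hq.le]
  have := (Real.sqrt_pos.2 hq).ne'
  field_simp

lemma quadForm_matA_pos (hl : 0 < lambdaMin (matA μ Y X)) {v : EuclideanSpace ℝ (Fin p)}
    (hv : v ≠ 0) : 0 < quadForm (matA μ Y X) v :=
  lt_of_lt_of_le (mul_pos hl (by positivity)) (lambdaMin_mul_le_quadForm (matA_isHermitian μ) v)

lemma abs_sum_normDiff_sq_sub_one_le (hl : 0 < lambdaMin (matA μ Y X)) {ω : Ω} (hθ : θ ω ≠ 0) :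
    |∑ k ∈ Finset.range (T - R), normDiff μ Y X θ R T k ω ^ 2 - 1|
      ≤ euclNorm (matAhat Y X R T ω - matA μ Y X) / lambdaMin (matA μ Y X) := by
  have hq := quadForm_matA_pos hl hθ
  have hl' := lambdaMin_mul_le_quadForm (matA_isHermitian μ (Y := Y) (X := X)) (θ ω)
  have hn : 0 < ‖θ ω‖ ^ 2 := by positivity
  have hE : 0 ≤ euclNorm (matAhat Y X R T ω - matA μ Y X) := Real.sqrt_nonneg _
  rw [sum_normDiff_sq ω hq.le, div_sub_one hq.ne', ← quadForm_sub, abs_div, abs_of_pos hq,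
    div_le_div_iff₀ hq hl]
  calc _ ≤ euclNorm (matAhat Y X R T ω - matA μ Y X) * ‖θ ω‖ ^ 2 * lambdaMin (matA μ Y X) := by
        gcongr
        exact abs_quadForm_le _ _
    _ = euclNorm (matAhat Y X R T ω - matA μ Y X) * (lambdaMin (matA μ Y X) * ‖θ ω‖ ^ 2) := by
        ring
    _ ≤ _ := by gcongr

/-- Cauchy–Schwarz puts `‖θ̂‖` in the numerator and the eigenvalue bound puts it in the denominator;
it cancels, so no moment of `θ̂` enters. -/
lemma abs_normDiff_le (hl : 0 < lambdaMin (matA μ Y X)) (k : ℕ) (ω : Ω) :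
    |normDiff μ Y X θ R T k ω|
      ≤ ‖Y (R + k + 1) ω • X (R + k + 1) ω‖ / √(((T - R : ℕ) : ℝ) * lambdaMin (matA μ Y X)) := by
  by_cases hθ : θ ω = 0
  · simp only [normDiff, hθ, inner_zero_right, zero_div, zero_mul, abs_zero]
    positivity
  by_cases hP : T - R = 0
  · simp [normDiff, hP]
  have hP' : (0 : ℝ) < ((T - R : ℕ) : ℝ) := by exact_mod_cast Nat.pos_of_ne_zero hP
  have hn : 0 < ‖θ ω‖ := norm_pos_iff.2 hθ
  have hs : √(lambdaMin (matA μ Y X)) * ‖θ ω‖ ≤ √(quadForm (matA μ Y X) (θ ω)) := by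
    refine Real.le_sqrt_of_sq_le ?_
    rw [mul_pow, Real.sq_sqrt hl.le]
    exact lambdaMin_mul_le_quadForm (matA_isHermitian μ) (θ ω)
  have hsl := Real.sqrt_pos.2 hl
  have hsP := Real.sqrt_pos.2 hP'
  have hsq : 0 < √(quadForm (matA μ Y X) (θ ω)) := Real.sqrt_pos.2 (quadForm_matA_pos hl hθ)
  have hin := abs_real_inner_le_norm (X (R + k + 1) ω) (θ ω)
  rw [normDiff, abs_mul, abs_div, abs_of_pos (mul_pos hsP hsq), norm_smul, Real.norm_eq_abs,
    Real.sqrt_mul hP'.le, div_mul_eq_mul_div, div_le_div_iff₀ (by positivity) (by positivity)]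
  calc _ ≤ ‖X (R + k + 1) ω‖ * ‖θ ω‖ * |Y (R + k + 1) ω|
        * (√((T - R : ℕ) : ℝ) * √(lambdaMin (matA μ Y X))) := by gcongr
    _ = |Y (R + k + 1) ω| * ‖X (R + k + 1) ω‖
        * (√((T - R : ℕ) : ℝ) * (√(lambdaMin (matA μ Y X)) * ‖θ ω‖)) := by ring
    _ ≤ _ := by gcongr

/-- `X_{R+k+1}` is predictable and `θ̂` is already known at time `R`. -/
lemma measurable_normDiff_weight
    (hXpred : ∀ t, Measurable[sigmaPast Y X (t - 1)] (X t))
    (hθ : Measurable[sigmaZ Y X (Set.Icc 1 (R : ℤ))] θ)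
    (k : ℕ) : Measurable[sigmaPast Y X (R + k)] fun ω =>
    inner ℝ (X (R + k + 1) ω) (θ ω)
      / (√((T - R : ℕ) : ℝ) * √(quadForm (matA μ Y X) (θ ω))) := by
  have hX' : Measurable[sigmaPast Y X (R + k)] (X (R + k + 1)) := by
    have h := hXpred (R + k + 1)
    rwa [add_sub_cancel_right] at h
  have hθ' : Measurable[sigmaPast Y X (R + k)] θ :=
    hθ.mono (sigmaZ_mono fun s hs => by
      have := hs.2
      simp only [Set.mem_Iic]; omega) le_rfl
  exact (hX'.inner hθ').div
    ((((measurable_quadForm (matA μ Y X)).comp hθ').sqrt).const_mul _)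

lemma measurable_normDiff
    (hY : ∀ t, Measurable (Y t)) (hX : ∀ t, Measurable (X t))
    (hXpred : ∀ t, Measurable[sigmaPast Y X (t - 1)] (X t))
    (hθ : Measurable[sigmaZ Y X (Set.Icc 1 (R : ℤ))] θ)
    (k : ℕ) :
    Measurable[pastFiltration hY hX R (k + 1)] (normDiff μ Y X θ R T k) := by
  have h1 := (measurable_normDiff_weight (μ := μ) (T := T) hXpred hθ k).mono
    (sigmaZ_mono (Y := Y) (X := X) (Set.Iic_subset_Iic.2
      (by push_cast; omega : (R + k : ℤ) ≤ R + (k + 1 : ℕ)))) le_rfl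
  have h2 : Measurable[pastFiltration hY hX R (k + 1)] (Y (R + k + 1)) := by
    have := measurable_sigmaPast_fst (Y := Y) (X := X) (R + k + 1)
    have e : (R + (k + 1 : ℕ) : ℤ) = R + k + 1 := by push_cast; ring
    change Measurable[sigmaPast Y X (R + (k + 1 : ℕ))] _
    rwa [e]
  exact Measurable.mul h1 h2

variable {δ : ℝ} {C : ℝ≥0}

lemma integrable_norm_smul_rpow
    (hY : ∀ t, Measurable (Y t)) (hX : ∀ t, Measurable (X t))
    (hδ : 0 < δ) {t : ℤ}
    (hmom : ∫⁻ ω, ‖Y t ω • X t ω‖ₑ ^ (2 + δ) ∂μ ≤ C) :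
    Integrable (fun ω => ‖Y t ω • X t ω‖ ^ (2 + δ)) μ
      ∧ ∫ ω, ‖Y t ω • X t ω‖ ^ (2 + δ) ∂μ ≤ C := by
  have hm : Measurable fun ω => ‖Y t ω • X t ω‖ ^ (2 + δ) :=
    ((hY t).smul (hX t)).norm.pow_const _
  have e : ∀ ω, ‖Y t ω • X t ω‖ₑ ^ (2 + δ) = ENNReal.ofReal (‖Y t ω • X t ω‖ ^ (2 + δ)) := by
    intro ω
    rw [← ofReal_norm, ENNReal.ofReal_rpow_of_nonneg (norm_nonneg _) (by linarith)]
  simp only [e] at hmom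
  refine ⟨⟨hm.aestronglyMeasurable, ?_⟩, ?_⟩
  · rw [hasFiniteIntegral_iff_ofReal (ae_of_all _ fun ω => by positivity)]
    exact hmom.trans_lt ENNReal.coe_lt_top
  · rw [integral_eq_lintegral_of_nonneg_ae (ae_of_all _ fun ω => by positivity)
      hm.aestronglyMeasurable]
    exact ENNReal.toReal_le_of_le_ofReal C.coe_nonneg (by simpa using hmom)

lemma abs_normDiff_rpow_le (hl : 0 < lambdaMin (matA μ Y X)) (hδ : 0 < δ) (k : ℕ) (ω : Ω) :
    |normDiff μ Y X θ R T k ω| ^ (2 + δ)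
      ≤ ‖Y (R + k + 1) ω • X (R + k + 1) ω‖ ^ (2 + δ)
        / (((T - R : ℕ) : ℝ) * lambdaMin (matA μ Y X)) ^ (1 + δ / 2) := by
  have h := Real.rpow_le_rpow (abs_nonneg _) (abs_normDiff_le (θ := θ) (R := R) (T := T) hl k ω)
    (by linarith : 0 ≤ 2 + δ)
  rw [Real.div_rpow (norm_nonneg _) (Real.sqrt_nonneg _), Real.sqrt_eq_rpow,
    ← Real.rpow_mul (by positivity)] at h
  convert h using 3
  ring

lemma integrable_abs_normDiff_rpow
    (hY : ∀ t, Measurable (Y t)) (hX : ∀ t, Measurable (X t))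
    (hXpred : ∀ t, Measurable[sigmaPast Y X (t - 1)] (X t))
    (hθ : Measurable[sigmaZ Y X (Set.Icc 1 (R : ℤ))] θ)
    (hl : 0 < lambdaMin (matA μ Y X)) (hδ : 0 < δ)
    (hmom : ∀ t, ∫⁻ ω, ‖Y t ω • X t ω‖ₑ ^ (2 + δ) ∂μ ≤ C) (k : ℕ) :
    Integrable (fun ω => |normDiff μ Y X θ R T k ω| ^ (2 + δ)) μ := by
  have hm : Measurable (normDiff μ Y X θ R T k) :=
    (measurable_normDiff hY hX hXpred hθ k).mono ((pastFiltration hY hX R).le _) le_rfl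
  refine ((integrable_norm_smul_rpow hY hX hδ (hmom (R + k + 1))).1.div_const
    ((((T - R : ℕ) : ℝ) * lambdaMin (matA μ Y X)) ^ (1 + δ / 2))).mono'
    ((hm.abs.pow_const _).aestronglyMeasurable) (ae_of_all _ fun ω => ?_)
  rw [Real.norm_of_nonneg (by positivity)]
  exact abs_normDiff_rpow_le hl hδ k ω

lemma sum_integral_abs_normDiff_rpow_le
    (hY : ∀ t, Measurable (Y t)) (hX : ∀ t, Measurable (X t))
    (hXpred : ∀ t, Measurable[sigmaPast Y X (t - 1)] (X t))
    (hθ : Measurable[sigmaZ Y X (Set.Icc 1 (R : ℤ))] θ)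
    (hl : 0 < lambdaMin (matA μ Y X)) (hδ : 0 < δ)
    (hmom : ∀ t, ∫⁻ ω, ‖Y t ω • X t ω‖ₑ ^ (2 + δ) ∂μ ≤ C) :
    ∑ k ∈ Finset.range (T - R), ∫ ω, |normDiff μ Y X θ R T k ω| ^ (2 + δ) ∂μ
      ≤ C / (lambdaMin (matA μ Y X) ^ (1 + δ / 2) * ((T - R : ℕ) : ℝ) ^ (δ / 2)) := by
  have h1 : ∀ k, ∫ ω, |normDiff μ Y X θ R T k ω| ^ (2 + δ) ∂μ
      ≤ C / (((T - R : ℕ) : ℝ) * lambdaMin (matA μ Y X)) ^ (1 + δ / 2) := by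
    intro k
    have hb := integrable_norm_smul_rpow hY hX hδ (hmom (R + k + 1))
    refine (integral_mono (integrable_abs_normDiff_rpow hY hX hXpred hθ hl hδ hmom k)
      (hb.1.div_const _) fun ω => abs_normDiff_rpow_le hl hδ k ω).trans ?_
    rw [integral_div]
    gcongr
    exact hb.2
  refine (Finset.sum_le_sum fun k _ => h1 k).trans ?_
  rw [Finset.sum_const, Finset.card_range, nsmul_eq_mul]
  by_cases hP : T - R = 0
  · simp only [hP, CharP.cast_eq_zero, zero_mul]
    positivity
  have hP' : (0 : ℝ) < ((T - R : ℕ) : ℝ) := by exact_mod_cast Nat.pos_of_ne_zero hP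
  rw [Real.mul_rpow hP'.le hl.le, Real.rpow_add hP', Real.rpow_one]
  refine le_of_eq ?_
  have := Real.rpow_pos_of_pos hP' (δ / 2)
  have := Real.rpow_pos_of_pos hl (1 + δ / 2)
  field_simp

/-- `v'Av = E[Y²(X'v)²] ≥ 0`, the moment bound making the entries of `A` genuine integrals. The sign
must be known separately because a real power of a negative base can be positive. -/
lemma lambdaMin_matA_nonneg [IsProbabilityMeasure μ]
    (hY : ∀ t, Measurable (Y t)) (hX : ∀ t, Measurable (X t)) (hδ : 0 < δ)
    (hmom : ∫⁻ ω, ‖Y 1 ω • X 1 ω‖ₑ ^ (2 + δ) ∂μ ≤ C) : 0 ≤ lambdaMin (matA μ Y X) := by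
  have hint : ∀ i j, Integrable (fun ω => Y 1 ω ^ 2 * (X 1 ω i * X 1 ω j)) μ := by
    intro i j
    refine ((integrable_const (1 : ℝ)).add (integrable_norm_smul_rpow hY hX hδ hmom).1).mono'
      (by have := hY 1; have := hX 1; fun_prop) (ae_of_all _ fun ω => ?_)
    have hi : |Y 1 ω * X 1 ω i| ≤ ‖Y 1 ω • X 1 ω‖ := PiLp.norm_apply_le (Y 1 ω • X 1 ω) i
    have hj : |Y 1 ω * X 1 ω j| ≤ ‖Y 1 ω • X 1 ω‖ := PiLp.norm_apply_le (Y 1 ω • X 1 ω) j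
    rw [show Y 1 ω ^ 2 * (X 1 ω i * X 1 ω j) = (Y 1 ω * X 1 ω i) * (Y 1 ω * X 1 ω j) by ring,
      Real.norm_eq_abs, abs_mul, Pi.add_apply]
    refine (mul_le_mul hi hj (abs_nonneg _) (norm_nonneg _)).trans ?_
    by_cases h2 : ‖Y 1 ω • X 1 ω‖ ≤ 1
    · have : 0 ≤ ‖Y 1 ω • X 1 ω‖ ^ (2 + δ) := by positivity
      nlinarith [norm_nonneg (Y 1 ω • X 1 ω)]
    · have := Real.rpow_le_rpow_of_exponent_le (le_of_not_ge h2) (by linarith : 2 ≤ 2 + δ)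
      rw [Real.rpow_two] at this
      nlinarith
  have hq : ∀ v, quadForm (matA μ Y X) v = ∫ ω, Y 1 ω ^ 2 * (inner ℝ (X 1 ω) v) ^ 2 ∂μ := by
    intro v
    simp only [← quadForm_outer, ← quadForm_smul]
    simp only [quadForm, matA, matrixMean, Matrix.of_apply, Matrix.smul_apply, outer, smul_eq_mul]
    rw [integral_finsetSum _ fun i _ => integrable_finsetSum _ fun j _ =>
      ((hint i j).const_mul _).mul_const _]
    refine Finset.sum_congr rfl fun i _ => ?_
    rw [integral_finsetSum _ fun j _ => ((hint i j).const_mul _).mul_const _]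
    simp only [integral_mul_const, integral_const_mul]
  have hps : (matA μ Y X).PosSemidef := by
    refine Matrix.PosSemidef.of_dotProduct_mulVec_nonneg (matA_isHermitian μ) fun v => ?_
    have e : dotProduct (star v) ((matA μ Y X).mulVec v)
        = quadForm (matA μ Y X) (WithLp.toLp 2 v) := by
      simp [dotProduct, Matrix.mulVec, quadForm, Finset.mul_sum, mul_assoc]
    rw [e, hq]
    exact integral_nonneg fun ω => by positivity
  refine Real.sInf_nonneg fun x hx => ?_
  rw [hps.isHermitian.spectrum_real_eq_range_eigenvalues] at hx
  obtain ⟨i, rfl⟩ := hx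
  exact hps.eigenvalues_nonneg i

/-- A coordinate equal to `1` gives `|Y| ≤ ‖Y X‖`. Integrability gives content to the martingale
difference hypothesis: `condExp` of a non-integrable function is `0` by default. -/
lemma integrable_of_intercept [IsProbabilityMeasure μ]
    (hY : ∀ t, Measurable (Y t)) (hX : ∀ t, Measurable (X t))
    (hδ : 0 < δ) {t : ℤ} {j : Fin p} (hj : ∀ᵐ ω ∂μ, X t ω j = 1)
    (hmom : ∫⁻ ω, ‖Y t ω • X t ω‖ₑ ^ (2 + δ) ∂μ ≤ C) : Integrable (Y t) μ := by
  refine ((integrable_const (1 : ℝ)).add (integrable_norm_smul_rpow hY hX hδ hmom).1).mono'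
    (hY t).aestronglyMeasurable ?_
  filter_upwards [hj] with ω hω
  have h1 : ‖Y t ω‖ ≤ ‖Y t ω • X t ω‖ := by
    have := PiLp.norm_apply_le (Y t ω • X t ω) j
    simpa [hω] using this
  refine h1.trans ?_
  rw [Pi.add_apply]
  by_cases h2 : ‖Y t ω • X t ω‖ ≤ 1
  · have : 0 ≤ ‖Y t ω • X t ω‖ ^ (2 + δ) := by positivity
    linarith
  · have := Real.rpow_le_rpow_of_exponent_le (le_of_not_ge h2) (by linarith : 1 ≤ 2 + δ)
    rw [Real.rpow_one] at this
    linarith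

lemma condExp_normDiff [IsProbabilityMeasure μ]
    (hY : ∀ t, Measurable (Y t)) (hX : ∀ t, Measurable (X t))
    (hXpred : ∀ t, Measurable[sigmaPast Y X (t - 1)] (X t))
    (hθ : Measurable[sigmaZ Y X (Set.Icc 1 (R : ℤ))] θ)
    (hl : 0 < lambdaMin (matA μ Y X)) (hδ : 0 < δ)
    (hint : ∃ j : Fin p, ∀ t, ∀ᵐ ω ∂μ, X t ω j = 1)
    (hmom : ∀ t, ∫⁻ ω, ‖Y t ω • X t ω‖ₑ ^ (2 + δ) ∂μ ≤ C)
    (hMDH : ∀ t, μ[Y t | sigmaPast Y X (t - 1)] =ᵐ[μ] 0) (k : ℕ) :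
    μ[normDiff μ Y X θ R T k | pastFiltration hY hX R k] =ᵐ[μ] 0 := by
  obtain ⟨j, hj⟩ := hint
  have hYint := integrable_of_intercept hY hX hδ (hj (R + k + 1)) (hmom (R + k + 1))
  have hm : Measurable (normDiff μ Y X θ R T k) :=
    (measurable_normDiff hY hX hXpred hθ k).mono ((pastFiltration hY hX R).le _) le_rfl
  have hDint : Integrable (normDiff μ Y X θ R T k) μ := by
    refine ((integrable_const (1 : ℝ)).add
      (integrable_abs_normDiff_rpow (T := T) hY hX hXpred hθ hl hδ hmom k)).mono'
      hm.aestronglyMeasurable (ae_of_all _ fun ω => ?_)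
    rw [Pi.add_apply, Real.norm_eq_abs]
    by_cases h2 : |normDiff μ Y X θ R T k ω| ≤ 1
    · have : 0 ≤ |normDiff μ Y X θ R T k ω| ^ (2 + δ) := by positivity
      linarith
    · have := Real.rpow_le_rpow_of_exponent_le (le_of_not_ge h2) (by linarith : 1 ≤ 2 + δ)
      rw [Real.rpow_one] at this
      linarith
  have h0 : μ[Y (R + k + 1) | sigmaPast Y X (R + k)] =ᵐ[μ] 0 := by
    have h := hMDH (R + k + 1)
    rwa [add_sub_cancel_right] at h
  -- The weight may be unbounded; it can be pulled out because the product and `Y` are both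
  -- integrable.
  have h := condExp_mul_of_stronglyMeasurable_left (μ := μ)
    (measurable_normDiff_weight (μ := μ) (T := T) hXpred hθ k).stronglyMeasurable hDint hYint
  refine h.trans ?_
  filter_upwards [h0] with ω hω
  simp [hω]

end Sample

theorem theorem5p1
    -- for every total sample size `T`: a probability space, a dimension, a process on `ℤ`
    {Ω : ℕ → Type*} [∀ T, MeasurableSpace (Ω T)]
    (μ : ∀ T, Measure (Ω T)) [∀ T, IsProbabilityMeasure (μ T)]
    (p : ℕ → ℕ)
    (Y : ∀ T, ℤ → Ω T → ℝ) (X : ∀ T, ℤ → Ω T → EuclideanSpace ℝ (Fin (p T)))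
    (hYmeas : ∀ T t, Measurable (Y T t)) (hXmeas : ∀ T t, Measurable (X T t))
    (hstat : ∀ T, StrictlyStationary (μ T) (fun t ω => (Y T t ω, X T t ω)))
    -- `X_t` is `F_{t-1}`-measurable and includes an intercept
    (hXpred : ∀ T t, Measurable[sigmaPast (Y T) (X T) (t - 1)] (X T t))
    (hintercept : ∀ T, ∃ j : Fin (p T), ∀ t, ∀ᵐ ω ∂(μ T), X T t ω j = 1)
    -- A1, with in-sample size `R T` and out-of-sample size `T - R T`
    (R : ℕ → ℕ) (hR : Tendsto R atTop atTop)
    (hP : Tendsto (fun T => T - R T) atTop atTop)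
    (π : ℝ) (hπ : 0 ≤ π)
    (hratio : Tendsto (fun T => ((T - R T : ℕ) : ℝ) / (R T : ℝ)) atTop (𝓝 π))
    -- the matrices `Σ` exist and their largest eigenvalues are bounded
    (hX2 : ∀ T t, MemLp (X T t) 2 (μ T))
    (Cmax : ℝ) (hSigma : ∀ T, lambdaMax (sigmaMat (μ T) (X T)) ≤ Cmax)
    -- A9 (i); the estimator is a function of the in-sample observations
    (Θ : ∀ T, Set (EuclideanSpace ℝ (Fin (p T)))) (hΘ : ∀ T, Bornology.IsBounded (Θ T))
    (θhat : ∀ T, Ω T → EuclideanSpace ℝ (Fin (p T)))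
    (hθmeas : ∀ T, Measurable[sigmaZ (Y T) (X T) (Set.Icc 1 (R T : ℤ))] (θhat T))
    (hθmem : ∀ T ω, θhat T ω ∈ Θ T)
    (hθzero : ∀ T, μ T {ω | θhat T ω = 0} = 0)
    -- A9 (ii), with a bound that does not depend on the sample size or the dimension
    (δ : ℝ) (hδ : 0 < δ) (CM : ℝ≥0)
    (hmom : ∀ T t, ∫⁻ ω, ‖Y T t ω • X T t ω‖ₑ ^ (2 + δ) ∂(μ T) ≤ CM)
    -- A9 (iii)
    (hrate : IsLittleOP μ
      (fun T ω => max
        (euclNorm (matAhat (Y T) (X T) (R T) T ω - matA (μ T) (Y T) (X T)))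
        (euclNorm (matBhat (μ T) (Y T) (X T) (R T) T ω - matA (μ T) (Y T) (X T))))
      (fun T => lambdaMin (matA (μ T) (Y T) (X T))))
    (heig : Tendsto (fun T =>
      lambdaMin (matA (μ T) (Y T) (X T)) ^ (1 + δ / 2) * ((T - R T : ℕ) : ℝ) ^ (δ / 2))
      atTop atTop)
    -- the martingale difference hypothesis
    (hMDH : ∀ T t, (μ T)[Y T t | sigmaPast (Y T) (X T) (t - 1)] =ᵐ[μ T] 0) :
    TendstoInDistribution (fun T => tStat (Y T) (X T) (θhat T) (R T) T) atTop
      (id : ℝ → ℝ) μ (gaussianReal 0 1) := by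
  have hl : ∀ᶠ T in atTop, 0 < lambdaMin (matA (μ T) (Y T) (X T)) := by
    filter_upwards [heig.eventually_gt_atTop 0] with T hT
    refine (lambdaMin_matA_nonneg (hYmeas T) (hXmeas T) hδ (hmom T 1)).lt_of_ne' fun h => ?_
    rw [h, Real.zero_rpow (by positivity), zero_mul] at hT
    exact lt_irrefl _ hT
  have hθm : ∀ T, Measurable (θhat T) := fun T =>
    (hθmeas T).mono (sigmaZ_le (hYmeas T) (hXmeas T) _) le_rfl
  have hθ0 : ∀ T, ∀ᵐ ω ∂(μ T), θhat T ω ≠ 0 := fun T => by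
    rw [ae_iff]; simpa using hθzero T
  -- The statistic equals the self-normalized sum only where `λ_min(A) > 0` and `θ̂ ≠ 0`, that is,
  -- for large `T` and almost surely.
  refine TendstoInDistribution.congr_eventually
    (tendstoInDistribution_selfNormalized_martingaleDiff μ
      (fun T => pastFiltration (hYmeas T) (hXmeas T) (R T))
      (fun T => normDiff (μ T) (Y T) (X T) (θhat T) (R T) T) (fun T => T - R T)
      (fun T k => measurable_normDiff _ _ (hXpred T) (hθmeas T) k) hδ ?_ ?_ ?_ ?_) ?_ ?_
  · filter_upwards [hl] with T hT k _
    exact integrable_abs_normDiff_rpow (hYmeas T) (hXmeas T) (hXpred T) (hθmeas T) hT hδ (hmom T) k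
  · filter_upwards [hl] with T hT k _
    exact condExp_normDiff _ _ (hXpred T) (hθmeas T) hT hδ (hintercept T) (hmom T) (hMDH T) k
  · refine squeeze_zero' (Eventually.of_forall fun T => Finset.sum_nonneg fun k _ =>
      integral_nonneg fun ω => by positivity) ?_ (heig.const_div_atTop (CM : ℝ))
    filter_upwards [hl] with T hT
    exact sum_integral_abs_normDiff_rpow_le (hYmeas T) (hXmeas T) (hXpred T) (hθmeas T) hT hδ
      (hmom T)
  · intro η hη
    refine tendsto_of_tendsto_of_tendsto_of_le_of_le' tendsto_const_nhds (hrate η hη)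
      (Eventually.of_forall fun _ => zero_le) ?_
    filter_upwards [hl] with T hT
    refine measure_mono_ae ?_
    filter_upwards [hθ0 T] with ω hω h
    have h1 := (lt_of_lt_of_le h (abs_sum_normDiff_sq_sub_one_le hT hω))
    rw [lt_div_iff₀ hT] at h1
    exact h1.trans_le ((le_max_left _ _).trans (le_abs_self _))
  · intro T
    have := hYmeas T
    have := hXmeas T
    have := hθm T
    unfold tStat outMean
    fun_prop
  · filter_upwards [hl] with T hT
    filter_upwards [hθ0 T] with ω hω
    exact tStat_eq ω (quadForm_matA_pos hT hω)
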